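/- **Lemma 2.1.** Let $n\ge 2$, let $G\subset\mathbb R^n$ be an open neighborhood of the origin, and let $F$ be a real-valued function on $G$ that is differentiable of class $C^\infty$, with $F(0)=0$, and positive definite ($F(x)>0$ for all $x\in G\setminus\{0\}$) or negative definite ($F(x)<0$ for all $x\in G\setminus\{0\}$). Then there are sets $H_i\subset G$ and real numbers $a_i$ ($i=1,2,\dots$) such that: 1. $(H_i)$ is a convergent sequence of hypersurfaces in $G$. That is, each $H_i$ is a nonempty connected compact smooth ($C^\infty$) embedded $(n-1)$-dimensional submanifold of $\mathbb R^n$ contained in $G$; the $H_i$ are pairwise disjoint; and there are compact sets $K_i\subset\mathbb R^n$ with $0\in K_i$, $0\notin H_i$, $\partial K_i=H_i$, with $K_i\supsetneq K_j$ for $i<j$, and with $\bigcap_i K_i=\{0\}$. 2. $F(H_i)=\{a_i\}$, and $a_i$ is a regular value of $F$ on $G$, i.e. $dF_x\neq 0$ for every $x\in G$ with $F(x)=a_i$. 3. $H_i$ is a connected component of the boundary $\partial P_i$ (taken in $\mathbb R^n$), where $P_i$ is the connected component containing the origin of the sublevel set $\{x\in G: 0\le F(x)\le a_i\}$ if $F$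 is positive definite, and of the set $\{x\in G: a_i\le F(x)\le 0\}$ if $F$ is negative definite. 4. $a_i\to 0$ as $i\to\infty$. -/

import Mathlib

open Set Filter Topology
open scoped ContDiff

/-- `S` is a smooth (i.e. `C^∞`) embedded submanifold of dimension `d` of `ℝⁿ`: around each of its
points there is a smooth chart of `ℝⁿ` (a homeomorphism between open sets, smooth with smooth
inverse) which turns `S` into the coordinate subspace `ℝᵈ × {0}`. -/
def IsSmoothSubmanifold {n : ℕ} (d : ℕ) (S : Set (EuclideanSpace ℝ (Fin n))) : Prop :=
  d ≤ n ∧ ∀ p ∈ S, ∃ φ : OpenPartialHomeomorph (EuclideanSpace ℝ (Fin n))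
      (EuclideanSpace ℝ (Fin n)),
    p ∈ φ.source ∧ ContDiffOn ℝ ∞ φ φ.source ∧ ContDiffOn ℝ ∞ φ.symm φ.target ∧
      ∀ x ∈ φ.source, x ∈ S ↔ ∀ k : Fin n, d ≤ (k : ℕ) → φ x k = 0

/-- A hypersurface in `G ⊆ ℝⁿ`: a (nonempty) connected compact smooth submanifold of dimension
`n - 1` which lies in `G`. -/
structure IsHypersurfaceIn {n : ℕ} (G H : Set (EuclideanSpace ℝ (Fin n))) : Prop where
  connected : IsConnected H
  compact : IsCompact H
  submanifold : IsSmoothSubmanifold (n - 1) H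
  subset : H ⊆ G

/-- `H` bounds the compact set `K` around the origin: the origin belongs to `K` but not to `H`,
and `H` is the boundary of `K`. -/
structure BoundsAroundOrigin {n : ℕ} (H K : Set (EuclideanSpace ℝ (Fin n))) : Prop where
  compact : IsCompact K
  zero_mem : (0 : EuclideanSpace ℝ (Fin n)) ∈ K
  zero_notMem : (0 : EuclideanSpace ℝ (Fin n)) ∉ H
  frontier_eq : frontier K = H

/-- A convergent sequence of hypersurfaces in `G`: pairwise disjoint hypersurfaces in `G` bounding
compact sets `K i` around the origin which decrease and intersect in the origin alone. -/
def IsConvergentSequence {n : ℕ} (G : Set (EuclideanSpace ℝ (Fin n)))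
    (H : ℕ → Set (EuclideanSpace ℝ (Fin n))) : Prop :=
  (∀ i, IsHypersurfaceIn G (H i)) ∧ (∀ i j, i ≠ j → Disjoint (H i) (H j)) ∧
    ∃ K : ℕ → Set (EuclideanSpace ℝ (Fin n)), (∀ i, BoundsAroundOrigin (H i) (K i)) ∧
      (⋂ i, K i) = {0} ∧ ∀ i j, i < j → K j ⊂ K i

/-- `F` is positive definite on `G`: it vanishes at the origin and is positive elsewhere on `G`. -/
def IsPosDefOn {n : ℕ} (F : EuclideanSpace ℝ (Fin n) → ℝ)
    (G : Set (EuclideanSpace ℝ (Fin n))) : Prop :=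
  F 0 = 0 ∧ ∀ x ∈ G, x ≠ 0 → 0 < F x

/-- `F` is negative definite on `G`: it vanishes at the origin and is negative elsewhere on `G`. -/
def IsNegDefOn {n : ℕ} (F : EuclideanSpace ℝ (Fin n) → ℝ)
    (G : Set (EuclideanSpace ℝ (Fin n))) : Prop :=
  F 0 = 0 ∧ ∀ x ∈ G, x ≠ 0 → F x < 0

/-- `a` is a regular value of the restriction of `F` to the open set `G`: at each point of `G`
where `F` takes the value `a`, the differential of `F` is surjective. -/
def IsRegularValueOn {n : ℕ} (F : EuclideanSpace ℝ (Fin n) → ℝ)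
    (G : Set (EuclideanSpace ℝ (Fin n))) (a : ℝ) : Prop :=
  ∀ x ∈ G, F x = a → Function.Surjective (fderiv ℝ F x)

/-- The connected component of the origin in the set `{x ∈ G | F x ∈ [0, a]}` (in
`{x ∈ G | F x ∈ [a, 0]}` if `a < 0`). For `F` positive definite and `0 < a` this is the component
of the origin in the sublevel set `{x ∈ G | F x ≤ a}`. -/
def originComponent {n : ℕ} (F : EuclideanSpace ℝ (Fin n) → ℝ)
    (G : Set (EuclideanSpace ℝ (Fin n))) (a : ℝ) : Set (EuclideanSpace ℝ (Fin n)) :=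
  connectedComponentIn {x | x ∈ G ∧ F x ∈ uIcc 0 a} 0

/-- `C` is one of the connected components of the set `S`. -/
def IsConnectedComponentOf {n : ℕ} (C S : Set (EuclideanSpace ℝ (Fin n))) : Prop :=
  ∃ x ∈ S, C = connectedComponentIn S x

/-! # Hypersurfaces in the level sets of a definite function -/

/-! Replacing F by -F, take F positive definite. On a small sphere of radius ε around 0, F has a
positive minimum; for a below it, the component P of 0 in {F ≤ a} cannot cross the sphere, so it is
compact. The boundary of P may have several pieces, as P may have holes. The right piece is the
outer one, H = ∂U, where U is the component of the complement of P containing a far point e, and K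
is the complement of U.

H is connected because ℝⁿ is unicoherent: the closure of U and K are closed connected sets covering
ℝⁿ, and they meet in H. By Morse–Sard, a can be chosen regular and arbitrarily small. Then near a
point of H the side {F ≤ a} lies in P and {F > a} in U, so H is locally the whole level set {F = a}:
it is smooth, and open and closed in ∂P. Letting ε and a decrease to 0 with e fixed makes the sets K
nested and shrinks them to the origin. -/

/-! ### Unicoherence and boundaries of complementary components -/

theorem IsPreconnected.eq_of_circleExp_eq_one {X : Type*} [TopologicalSpace X] {s : Set X}
    (hs : IsPreconnected s) {f : X → ℝ} (hf : ContinuousOn f s)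
    (h : ∀ x ∈ s, Circle.exp (f x) = 1) {x y : X} (hx : x ∈ s) (hy : y ∈ s) : f x = f y := by
  have hT : DiscreteTopology (AddSubgroup.zmultiples (2 * Real.pi) : Set ℝ) :=
    inferInstanceAs (DiscreteTopology (AddSubgroup.zmultiples (2 * Real.pi)))
  refine hs.constant_of_mapsTo (T := (AddSubgroup.zmultiples (2 * Real.pi) : Set ℝ)) ⟨hT⟩ hf
    (fun z hz => ?_) hx hy
  obtain ⟨m, hm⟩ := Circle.exp_eq_one.1 (h z hz)
  exact AddSubgroup.mem_zmultiples_iff.2 ⟨m, by rw [hm]; simp⟩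

/-- Unicoherence of simply connected spaces. -/
theorem IsPreconnected.inter_of_isClosed_of_union_eq_univ {X : Type*} [TopologicalSpace X]
    [NormalSpace X] [SimplyConnectedSpace X] [LocallyPathConnectedSpace X] {K V : Set X}
    (hK : IsPreconnected K) (hV : IsPreconnected V) (hKc : IsClosed K) (hVc : IsClosed V)
    (hKV : K ∪ V = univ) : IsPreconnected (K ∩ V) := by
  classical
  rw [isPreconnected_closed_iff]
  intro t t' ht ht' hst ⟨p, hp⟩ ⟨q, hq⟩
  by_contra hne
  have hd : Disjoint (K ∩ V ∩ t) (K ∩ V ∩ t') := by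
    rw [Set.disjoint_left]
    rintro x ⟨hx, hxt⟩ ⟨-, hxt'⟩
    exact hne ⟨x, hx, hxt, hxt'⟩
  obtain ⟨u, hu0, hu1, -⟩ := exists_continuous_zero_one_of_isClosed
    ((hKc.inter hVc).inter ht) ((hKc.inter hVc).inter ht') hd
  -- A separation of K ∩ V gives u with values 0 and 1 there, so exp(iπu) on K and exp(-iπu) off K
  -- glue to a circle-valued map. It has a real lift θ; θ - πu is constant on K and θ + πu on V.
  -- Comparing p (u = 0) with q (u = 1) gives θ p = θ q - π = θ q + π.
  have hagree : ∀ x ∈ K ∩ V, Circle.exp (Real.pi * u x) = Circle.exp (-(Real.pi * u x)) := by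
    intro x hx
    rcases hst hx with h | h
    · simp [hu0 ⟨hx, h⟩]
    · rw [hu1 ⟨hx, h⟩, Circle.exp_eq_exp]
      exact ⟨1, by simp; ring⟩
  have hfr : frontier K ⊆ K ∩ V := by
    intro x hx
    refine ⟨hKc.frontier_subset hx, ?_⟩
    rw [frontier_eq_closure_inter_closure] at hx
    refine closure_minimal ?_ hVc hx.2
    intro y hy
    exact ((hKV ▸ mem_univ y : y ∈ K ∪ V)).resolve_left hy
  have hc : Continuous (K.piecewise (fun x => Circle.exp (Real.pi * u x))
      (fun x => Circle.exp (-(Real.pi * u x)))) := by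
    refine Continuous.piecewise (fun x hx => hagree x (hfr hx)) ?_ ?_ <;> fun_prop
  set f := K.piecewise (fun x => Circle.exp (Real.pi * u x))
      (fun x => Circle.exp (-(Real.pi * u x))) with hf
  obtain ⟨θ, ⟨-, hθ⟩, -⟩ := Circle.isCoveringMap_exp.existsUnique_continuousMap_lifts
    (⟨f, hc⟩ : C(X, Circle)) p (Real.pi * u p)
    (by simp [hf, piecewise_eq_of_mem _ _ _ hp.1.1])
  have hθ' : ∀ x, Circle.exp (θ x) = f x := fun x => congrFun hθ x
  have h1 : θ p - Real.pi * u p = θ q - Real.pi * u q := by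
    refine hK.eq_of_circleExp_eq_one (f := fun x => θ x - Real.pi * u x)
      (by fun_prop) (fun x hx => ?_) hp.1.1 hq.1.1
    rw [Circle.exp_sub, hθ', hf, piecewise_eq_of_mem _ _ _ hx, div_self']
  have h2 : θ p + Real.pi * u p = θ q + Real.pi * u q := by
    refine hV.eq_of_circleExp_eq_one (f := fun x => θ x + Real.pi * u x)
      (by fun_prop) (fun x hx => ?_) hp.1.2 hq.1.2
    have : f x = Circle.exp (-(Real.pi * u x)) := by
      by_cases hxK : x ∈ K
      · rw [hf, piecewise_eq_of_mem _ _ _ hxK, hagree x ⟨hxK, hx⟩]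
      · rw [hf, piecewise_eq_of_notMem _ _ _ hxK]
    rw [Circle.exp_add, hθ', this, ← Circle.exp_add]
    simp
  have hp0 : u p = 0 := hu0 hp
  have hq1 : u q = 1 := hu1 hq
  rw [hp0, hq1] at h1 h2
  have := Real.pi_pos
  linarith

theorem IsClosed.frontier_connectedComponentIn_compl_subset {X : Type*} [TopologicalSpace X]
    [LocallyConnectedSpace X] {P : Set X} (hP : IsClosed P) (x : X) :
    frontier (connectedComponentIn Pᶜ x) ⊆ P := by
  intro z hz
  by_contra hzP
  have hopen := hP.isOpen_compl.connectedComponentIn (x := x)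
  have hzopen := hP.isOpen_compl.connectedComponentIn (x := z)
  have hzm : z ∈ connectedComponentIn Pᶜ z := mem_connectedComponentIn hzP
  obtain ⟨w, hwz, hwx⟩ := mem_closure_iff.1 hz.1 _ hzopen hzm
  have h := (connectedComponentIn_eq hwz).trans (connectedComponentIn_eq hwx).symm
  rw [h] at hzm
  rw [hopen.frontier_eq] at hz
  exact hz.2 hzm

/-- The complement consists of P and the other components of Pᶜ. Each of these has a frontier point,
since the space is connected, and that point lies in P; so each is attached to P. -/
theorem isPreconnected_compl_connectedComponentIn_compl {X : Type*} [TopologicalSpace X]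
    [ConnectedSpace X] [LocallyConnectedSpace X] {P : Set X} (hP : IsPreconnected P)
    (hPc : IsClosed P) {p : X} (hp : p ∈ P) (x : X) :
    IsPreconnected (connectedComponentIn Pᶜ x)ᶜ := by
  refine isPreconnected_of_forall p fun y hy => ?_
  by_cases hyP : y ∈ P
  · refine ⟨P, fun z hz hz' => ?_, hp, hyP, hP⟩
    exact connectedComponentIn_subset _ _ hz' hz
  · have hpC : p ∉ connectedComponentIn Pᶜ y := fun h => connectedComponentIn_subset _ _ h hp
    have hne : (frontier (connectedComponentIn Pᶜ y)).Nonempty := by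
      rw [nonempty_frontier_iff]
      exact ⟨⟨y, mem_connectedComponentIn hyP⟩, fun h => hpC (h ▸ mem_univ p)⟩
    obtain ⟨z, hz⟩ := hne
    have hzP := hPc.frontier_connectedComponentIn_compl_subset y hz
    have hzC : IsPreconnected (insert z (connectedComponentIn Pᶜ y)) :=
      isPreconnected_connectedComponentIn.subset_closure (subset_insert _ _)
        (insert_subset hz.1 subset_closure)
    refine ⟨P ∪ insert z (connectedComponentIn Pᶜ y), ?_, Or.inl hp,
      Or.inr (Or.inr (mem_connectedComponentIn hyP)), hP.union z hzP (mem_insert _ _) hzC⟩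
    have key : ∀ w ∈ P, w ∉ connectedComponentIn Pᶜ x := fun w hw hw' =>
      connectedComponentIn_subset _ _ hw' hw
    rintro w (hw | rfl | hw)
    · exact key w hw
    · exact key w hzP
    · intro hw'
      have h := (connectedComponentIn_eq hw).trans (connectedComponentIn_eq hw').symm
      exact hy (h ▸ mem_connectedComponentIn hyP)

theorem isPreconnected_frontier_connectedComponentIn_compl {X : Type*} [TopologicalSpace X]
    [NormalSpace X] [SimplyConnectedSpace X] [LocallyPathConnectedSpace X] {P : Set X}
    (hP : IsPreconnected P) (hPc : IsClosed P) {p : X} (hp : p ∈ P) (x : X) :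
    IsPreconnected (frontier (connectedComponentIn Pᶜ x)) := by
  have hopen := hPc.isOpen_compl.connectedComponentIn (x := x)
  rw [hopen.frontier_eq, sdiff_eq, inter_comm]
  refine (isPreconnected_compl_connectedComponentIn_compl hP hPc hp x).inter_of_isClosed_of_union_eq_univ
    isPreconnected_connectedComponentIn.closure hopen.isClosed_compl isClosed_closure ?_
  rw [eq_univ_iff_forall]
  intro y
  by_cases hy : y ∈ connectedComponentIn Pᶜ x
  · exact Or.inr (subset_closure hy)
  · exact Or.inl hy

theorem isPreconnected_compl_closedBall_zero {E : Type*} [NormedAddCommGroup E] [NormedSpace ℝ E]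
    (h : 1 < Module.rank ℝ E) {r : ℝ} (hr : 0 ≤ r) :
    IsPreconnected (Metric.closedBall (0 : E) r)ᶜ := by
  have himage : (Metric.closedBall (0 : E) r)ᶜ =
      (fun q : E × ℝ => q.2 • q.1) '' (Metric.sphere 0 1 ×ˢ Ioi r) := by
    ext x
    simp only [mem_compl_iff, mem_closedBall_zero_iff, not_le, mem_image, mem_prod,
      mem_sphere_zero_iff_norm, mem_Ioi, Prod.exists]
    constructor
    · intro hx
      have h0 : 0 < ‖x‖ := hr.trans_lt hx
      exact ⟨‖x‖⁻¹ • x, ‖x‖, ⟨by rw [norm_smul, norm_inv, norm_norm, inv_mul_cancel₀ h0.ne'], hx⟩,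
        by rw [smul_smul, mul_inv_cancel₀ h0.ne', one_smul]⟩
    · rintro ⟨v, t, ⟨hv, ht⟩, rfl⟩
      rwa [norm_smul, hv, mul_one, Real.norm_of_nonneg (hr.trans ht.le)]
  rw [himage]
  exact ((isPreconnected_sphere h 0 1).prod isPreconnected_Ioi).image _ (by fun_prop)

/-! ### Straightening charts -/

theorem ContDiffOn.exists_straightening {n : ℕ} {g : EuclideanSpace ℝ (Fin (n + 1)) → ℝ}
    {G : Set (EuclideanSpace ℝ (Fin (n + 1)))} (hG : IsOpen G) (hg : ContDiffOn ℝ ∞ g G)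
    {p : EuclideanSpace ℝ (Fin (n + 1))} (hp : p ∈ G) (hgp : fderiv ℝ g p ≠ 0) :
    ∃ φ : OpenPartialHomeomorph (EuclideanSpace ℝ (Fin (n + 1))) (EuclideanSpace ℝ (Fin (n + 1))),
      p ∈ φ.source ∧ φ.source ⊆ G ∧ ContDiffOn ℝ ∞ φ φ.source ∧
      ContDiffOn ℝ ∞ φ.symm φ.target ∧ Convex ℝ φ.target ∧
      ∀ x ∈ φ.source, φ x (Fin.last n) = g x := by
  set e : EuclideanSpace ℝ (Fin (n + 1)) := EuclideanSpace.single (Fin.last n) 1 with he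
  set π : EuclideanSpace ℝ (Fin (n + 1)) →L[ℝ] ℝ := EuclideanSpace.proj (Fin.last n) with hπ
  obtain ⟨v, hv⟩ := (InnerProductSpace.toDual ℝ (EuclideanSpace ℝ (Fin (n + 1)))).surjective (fderiv ℝ g p)
  have hv0 : v ≠ 0 := by
    rintro rfl
    exact hgp (by rw [← hv, map_zero])
  have hvn : ‖v‖ ≠ 0 := norm_ne_zero_iff.2 hv0
  -- This reflection takes the gradient v to ‖v‖e; scaled by ‖v‖ it is a linear isomorphism L whose
  -- last coordinate is the differential of g at p.
  set R := (Submodule.span ℝ {v - ‖v‖ • e})ᗮ.reflection with hR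
  have hRv : R v = ‖v‖ • e := by
    apply Submodule.reflection_sub
    rw [norm_smul, norm_norm, he, PiLp.norm_single]
    simp
  set L : EuclideanSpace ℝ (Fin (n + 1)) ≃L[ℝ] EuclideanSpace ℝ (Fin (n + 1)) := R.toContinuousLinearEquiv.trans
    (ContinuousLinearEquiv.smulLeft (Units.mk0 ‖v‖ hvn)) with hL
  have hLx : ∀ x, L x = ‖v‖ • R x := fun x => rfl
  have hLπ : ∀ x, π (L x) = fderiv ℝ g p x := by
    intro x
    have h1 : π (R x) = Inner.inner ℝ e (R x) := by
      simp [hπ, he, EuclideanSpace.inner_single_left]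
    rw [hLx, map_smul, smul_eq_mul, h1, ← real_inner_smul_left, ← hRv, R.inner_map_map, ← hv]
    rfl
  -- Correcting the last coordinate of L to g does not change the derivative at p, so the inverse
  -- function theorem applies to Φ.
  set Φ : EuclideanSpace ℝ (Fin (n + 1)) → EuclideanSpace ℝ (Fin (n + 1)) := fun x => L x + (g x - π (L x)) • e with hΦ
  have hΦc : ContDiffOn ℝ ∞ Φ G := by
    have h1 : ContDiff ℝ ∞ (fun x => L x) := L.contDiff
    have h2 : ContDiff ℝ ∞ (fun x => π (L x)) := π.contDiff.comp L.contDiff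
    exact h1.contDiffOn.add ((hg.sub h2.contDiffOn).smul contDiffOn_const)
  have hgd : HasFDerivAt g (fderiv ℝ g p) p :=
    ((hg.contDiffAt (hG.mem_nhds hp)).differentiableAt (by simp)).hasFDerivAt
  have hΦd : HasFDerivAt Φ (L : EuclideanSpace ℝ (Fin (n + 1)) →L[ℝ] EuclideanSpace ℝ (Fin (n + 1))) p := by
    have h1 : HasFDerivAt (fun x => L x) (L : EuclideanSpace ℝ (Fin (n + 1)) →L[ℝ] EuclideanSpace ℝ (Fin (n + 1))) p := L.hasFDerivAt
    have h2 : HasFDerivAt (fun x => π (L x)) (π.comp (L : EuclideanSpace ℝ (Fin (n + 1)) →L[ℝ] EuclideanSpace ℝ (Fin (n + 1)))) p := π.hasFDerivAt.comp p h1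
    refine (h1.add ((hgd.sub h2).smul_const e)).congr_fderiv ?_
    ext1 x
    simp [hLπ]
  have hΦp : ContDiffAt ℝ ∞ Φ p := hΦc.contDiffAt (hG.mem_nhds hp)
  set φ₀ := hΦp.toOpenPartialHomeomorph Φ hΦd (by simp) with hφ₀
  have hφ₀p : p ∈ φ₀.source := hΦp.mem_toOpenPartialHomeomorph_source hΦd (by simp)
  -- The derivative of Φ stays invertible on S, which makes the inverse smooth on the whole target.
  set S : Set (EuclideanSpace ℝ (Fin (n + 1))) := G ∩ fderiv ℝ Φ ⁻¹' range ((↑) : (EuclideanSpace ℝ (Fin (n + 1)) ≃L[ℝ] EuclideanSpace ℝ (Fin (n + 1))) → EuclideanSpace ℝ (Fin (n + 1)) →L[ℝ] EuclideanSpace ℝ (Fin (n + 1))) with hS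
  have hSo : IsOpen S :=
    (hΦc.continuousOn_fderiv_of_isOpen hG (by simp)).isOpen_inter_preimage hG
      (ContinuousLinearEquiv.isOpen)
  have hpS : p ∈ S := ⟨hp, L, hΦd.fderiv.symm⟩
  set φ₁ := φ₀.restrOpen S hSo with hφ₁
  have hφ₁s : φ₁.source = φ₀.source ∩ S := φ₀.restrOpen_source S hSo
  have hφ₁p : p ∈ φ₁.source := hφ₁s ▸ ⟨hφ₀p, hpS⟩
  obtain ⟨r, hr, hball⟩ := Metric.isOpen_iff.1 φ₁.open_target _ (φ₁.map_source hφ₁p)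
  set φ := (φ₁.symm.restrOpen (Metric.ball (φ₁ p) r) Metric.isOpen_ball).symm with hφ
  have hφt : φ.target = Metric.ball (φ₁ p) r := by
    change (φ₁.symm.restrOpen (Metric.ball (φ₁ p) r) Metric.isOpen_ball).source = _
    rw [OpenPartialHomeomorph.restrOpen_source]
    exact inter_eq_right.2 hball
  have hφΦ : ∀ x, φ x = Φ x := fun x => rfl
  have hφs : φ.source ⊆ S := by
    intro x hx
    have h1 : φ x ∈ φ.target := φ.map_source hx
    have h2 : φ.symm (φ x) = x := φ.left_inv hx
    have h3 : φ₁.symm (φ x) ∈ φ₁.source := φ₁.map_target (hball (hφt ▸ h1))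
    have h4 : φ₁.symm (φ x) = x := h2
    rw [h4, hφ₁s] at h3
    exact h3.2
  refine ⟨φ, ?_, fun x hx => (hφs hx).1, ?_, ?_, ?_, ?_⟩
  · have h1 : φ.symm (φ₁ p) ∈ φ.source := φ.map_target (hφt ▸ Metric.mem_ball_self hr)
    have h2 : φ.symm (φ₁ p) = p := φ₁.left_inv hφ₁p
    rwa [h2] at h1
  · exact hΦc.mono fun x hx => (hφs hx).1
  · intro y hy
    have hx := hφs (φ.map_target hy)
    obtain ⟨A, hA⟩ := hx.2
    have hc : ContDiffAt ℝ ∞ Φ (φ.symm y) := hΦc.contDiffAt (hG.mem_nhds hx.1)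
    refine (φ.contDiffAt_symm (f₀' := A) hy ?_ hc).contDiffWithinAt
    rw [hA]
    exact (hc.differentiableAt (by simp)).hasFDerivAt
  · rw [hφt]
    exact convex_ball _ _
  · intro x _
    rw [hφΦ]
    change π (Φ x) = g x
    simp [hΦ, hπ, he]

/-! ### The Morse–Sard theorem through Hausdorff dimension -/

/-- Taylor's estimate, with constants uniform in the flat point x: bound the derivative of order k +
1 near p, then descend one order at a time by the mean value inequality on segments. -/
theorem ContDiffOn.exists_norm_sub_le_of_iteratedFDeriv_eq_zero {E : Type*} [NormedAddCommGroup E]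
    [NormedSpace ℝ E] {F : E → ℝ} {G : Set E} (hG : IsOpen G) (hF : ContDiffOn ℝ ∞ F G) {p : E}
    (hp : p ∈ G) (k : ℕ) :
    ∃ C : ℝ, 0 ≤ C ∧ ∃ r > 0, ∀ x ∈ Metric.ball p r, ∀ y ∈ Metric.ball p r,
      (∀ j, 1 ≤ j → j ≤ k → iteratedFDeriv ℝ j F x = 0) → ‖F y - F x‖ ≤ C * ‖y - x‖ ^ (k + 1) := by
  have hsm : ∀ (j : ℕ), ∀ x ∈ G, ContDiffAt ℝ ∞ (iteratedFDeriv ℝ j F) x := fun j x hx =>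
    (hF.contDiffAt (hG.mem_nhds hx)).iteratedFDeriv_right (by exact_mod_cast le_top)
  have hcont : ContinuousAt (fun x => ‖iteratedFDeriv ℝ (k + 1) F x‖) p :=
    (hsm (k + 1) p hp).continuousAt.norm
  obtain ⟨r, hr, hball⟩ := Metric.mem_nhds_iff.1
    (inter_mem (hG.mem_nhds hp) (hcont.eventually_lt_const (lt_add_one _)))
  set M := ‖iteratedFDeriv ℝ (k + 1) F p‖ + 1 with hM
  have hM0 : 0 ≤ M := by positivity
  refine ⟨M, hM0, r, hr, fun x hx y hy hflat => ?_⟩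
  have hsub : ∀ y ∈ Metric.ball p r, ∀ z ∈ segment ℝ x y, z ∈ Metric.ball p r ∧ ‖z - x‖ ≤ ‖y - x‖ :=
    fun y hy z hz => ⟨(convex_ball p r).segment_subset hx hy hz, by
      have := norm_sub_le_of_mem_segment hz
      simpa [norm_sub_rev] using this⟩
  have key : ∀ i, i ≤ k → ∀ y ∈ Metric.ball p r,
      ‖iteratedFDeriv ℝ (k + 1 - i) F y‖ ≤ M * ‖y - x‖ ^ i := by
    intro i
    induction i with
    | zero => intro _ y hy; simpa using (hball hy).2.le
    | succ i ih =>
      intro hi y hy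
      have hj : k + 1 - (i + 1) + 1 = k + 1 - i := by omega
      have h := (convex_segment x y).norm_image_sub_le_of_norm_fderiv_le
        (f := iteratedFDeriv ℝ (k + 1 - (i + 1)) F) (C := M * ‖y - x‖ ^ i) (𝕜 := ℝ)
        (fun z hz => (hsm _ z (hball (hsub y hy z hz).1).1).differentiableAt (by simp))
        (fun z hz => by
          rw [norm_fderiv_iteratedFDeriv, hj]
          refine (ih (by omega) z (hsub y hy z hz).1).trans ?_
          have := (hsub y hy z hz).2
          gcongr)
        (left_mem_segment ℝ x y) (right_mem_segment ℝ x y)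
      rw [hflat _ (by omega) (by omega), sub_zero] at h
      rwa [pow_succ, ← mul_assoc]
  have h := (convex_segment x y).norm_image_sub_le_of_norm_fderiv_le
        (f := F) (C := M * ‖y - x‖ ^ k) (𝕜 := ℝ)
        (fun z hz => (hF.contDiffAt (hG.mem_nhds (hball (hsub y hy z hz).1).1)).differentiableAt
          (by simp))
        (fun z hz => by
          have h1 := key k le_rfl z (hsub y hy z hz).1
          rw [Nat.add_sub_cancel_left, norm_iteratedFDeriv_one] at h1
          refine h1.trans ?_
          have := (hsub y hy z hz).2
          gcongr)
        (left_mem_segment ℝ x y) (right_mem_segment ℝ x y)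
  rwa [pow_succ, ← mul_assoc]

theorem dimH_image_le_of_locally {X Y : Type*} [MetricSpace X] [SecondCountableTopology X]
    [MetricSpace Y] {f : X → Y} {s : Set X} {d : ENNReal}
    (h : ∀ x ∈ s, ∃ t ∈ 𝓝[s] x, dimH (f '' t) ≤ d) : dimH (f '' s) ≤ d := by
  choose! t htn ht using h
  obtain ⟨u, hus, huc, huU⟩ := TopologicalSpace.countable_cover_nhdsWithin htn
  refine (dimH_mono (image_mono huU)).trans ?_
  rw [image_iUnion₂, dimH_bUnion huc]
  exact iSup₂_le fun x hx => ht x (hus hx)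

/-- The **Morse–Sard theorem** for real-valued functions. -/
theorem ContDiffOn.dimH_image_critical_le (n : ℕ) {F : EuclideanSpace ℝ (Fin n) → ℝ}
    {G : Set (EuclideanSpace ℝ (Fin n))} (hG : IsOpen G) (hF : ContDiffOn ℝ ∞ F G) :
    dimH (F '' {x | x ∈ G ∧ fderiv ℝ F x = 0}) ≤ n / (n + 1) := by
  induction n with
  | zero => rw [dimH_subsingleton (subsingleton_of_subsingleton.image F)]; simp
  | succ n ih =>
    -- Stratify by the order of flatness: on `s k` the first nonzero derivative has order k + 2,
    -- while on `t` all derivatives of orders 1 to n + 1 vanish.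
    set s : ℕ → Set (EuclideanSpace ℝ (Fin (n + 1))) := fun k =>
      {x | x ∈ G ∧ (∀ j, 1 ≤ j → j ≤ k + 1 → iteratedFDeriv ℝ j F x = 0) ∧
        iteratedFDeriv ℝ (k + 2) F x ≠ 0} with hs
    set t : Set (EuclideanSpace ℝ (Fin (n + 1))) :=
      {x | x ∈ G ∧ ∀ j, 1 ≤ j → j ≤ n + 1 → iteratedFDeriv ℝ j F x = 0} with ht
    have hsm : ∀ (j : ℕ), ∀ x ∈ G, ContDiffAt ℝ ∞ (iteratedFDeriv ℝ j F) x := fun j x hx =>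
      (hF.contDiffAt (hG.mem_nhds hx)).iteratedFDeriv_right (by exact_mod_cast le_top)
    have hone : ∀ x, iteratedFDeriv ℝ 1 F x = 0 ↔ fderiv ℝ F x = 0 := fun x => by
      rw [← norm_eq_zero, norm_iteratedFDeriv_one, norm_eq_zero]
    have hcover : {x | x ∈ G ∧ fderiv ℝ F x = 0} ⊆ (⋃ k, s k) ∪ t := by
      rintro x ⟨hxG, hx⟩
      by_cases hxt : ∀ k, iteratedFDeriv ℝ (k + 2) F x = 0
      · refine Or.inr ⟨hxG, fun j hj _ => ?_⟩
        obtain rfl | hj' := hj.eq_or_lt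
        · exact (hone x).2 hx
        · obtain ⟨i, rfl⟩ := Nat.exists_eq_add_of_le' hj'
          exact hxt i
      · push Not at hxt
        classical
        refine Or.inl (mem_iUnion.2 ⟨Nat.find hxt, hxG, fun j hj hjk => ?_, Nat.find_spec hxt⟩)
        obtain rfl | hj' := hj.eq_or_lt
        · exact (hone x).2 hx
        · obtain ⟨i, rfl⟩ := Nat.exists_eq_add_of_le' hj'
          exact not_not.1 (Nat.find_min hxt (m := i) (by omega))
    have hst : ∀ k, dimH (F '' s k) ≤ n / (n + 1) := by
      intro k
      refine dimH_image_le_of_locally fun x hx => ?_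
      obtain ⟨hxG, hxz, hxn⟩ := hx
      -- Some component g of the derivative of order k + 1 vanishes on `s k` but has nonzero
      -- differential at x. Locally `s k` thus lies in the smooth hypersurface {g = 0}; F restricted
      -- to it is a function of n variables, still critical at these points, and induction applies.
      obtain ⟨v, m, hvm⟩ : ∃ v m, fderiv ℝ (iteratedFDeriv ℝ (k + 1) F) x v m ≠ 0 := by
        by_contra! hcon
        have h0 : fderiv ℝ (iteratedFDeriv ℝ (k + 1) F) x = 0 := by
          ext v m
          exact hcon v m
        apply hxn
        rw [← norm_eq_zero, ← norm_fderiv_iteratedFDeriv, h0]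
        exact ContinuousLinearMap.opNorm_zero
      set ℓ := ContinuousMultilinearMap.apply ℝ
        (fun _ : Fin (k + 1) => EuclideanSpace ℝ (Fin (n + 1))) ℝ m with hℓ
      set g := fun y => ℓ (iteratedFDeriv ℝ (k + 1) F y) with hg
      have hgs : ContDiffOn ℝ ∞ g G := fun y hy =>
        (ℓ.contDiff.contDiffAt.comp y (hsm (k + 1) y hy)).contDiffWithinAt
      have hgd : fderiv ℝ g x ≠ 0 := by
        intro h
        have h1 : HasFDerivAt g (ℓ.comp (fderiv ℝ (iteratedFDeriv ℝ (k + 1) F) x)) x :=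
          ℓ.hasFDerivAt.comp x ((hsm (k + 1) x hxG).differentiableAt (by simp)).hasFDerivAt
        rw [h1.fderiv] at h
        exact hvm (DFunLike.congr_fun h v)
      obtain ⟨φ, hxφ, hφG, -, hφc, -, hφg⟩ := hgs.exists_straightening hG hxG hgd
      refine ⟨s k ∩ φ.source, inter_mem_nhdsWithin _ (φ.open_source.mem_nhds hxφ), ?_⟩
      set ι : EuclideanSpace ℝ (Fin n) →L[ℝ] EuclideanSpace ℝ (Fin (n + 1)) :=
        LinearMap.toContinuousLinearMap
          { toFun := fun z => WithLp.toLp 2 (Fin.snoc (α := fun _ => ℝ) (fun i => z i) 0)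
            map_add' := fun a b => by
              ext i
              refine Fin.lastCases ?_ (fun j => ?_) i <;> simp
            map_smul' := fun c a => by
              ext i
              refine Fin.lastCases ?_ (fun j => ?_) i <;> simp } with hι
      have hιmem : ∀ y : EuclideanSpace ℝ (Fin (n + 1)), y (Fin.last n) = 0 → ∃ z, ι z = y := by
        intro y hy
        refine ⟨WithLp.toLp 2 fun i => y i.castSucc, ?_⟩
        ext i
        refine Fin.lastCases ?_ (fun j => ?_) i
        · simp [hι, hy]
        · simp [hι]
      have hopen : IsOpen (ι ⁻¹' φ.target) := φ.open_target.preimage ι.continuous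
      have hFc : ContDiffOn ℝ ∞ (fun z => F (φ.symm (ι z))) (ι ⁻¹' φ.target) :=
        hF.comp (hφc.comp ι.contDiff.contDiffOn fun z hz => hz)
          fun z hz => hφG (φ.map_target hz)
      refine (dimH_mono ?_).trans (ih hopen hFc)
      rintro _ ⟨y, ⟨⟨hyG, hyz, -⟩, hyφ⟩, rfl⟩
      obtain ⟨z, hz⟩ := hιmem (φ y) (by
        rw [hφg y hyφ, hg]
        simp [hyz (k + 1) (by omega) le_rfl])
      have hzy : φ.symm (ι z) = y := by rw [hz, φ.left_inv hyφ]
      have hzt : ι z ∈ φ.target := hz ▸ φ.map_source hyφ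
      refine ⟨z, ⟨hzt, ?_⟩, by simp only [hzy]⟩
      have h1 : HasFDerivAt F (0 : EuclideanSpace ℝ (Fin (n + 1)) →L[ℝ] ℝ) (φ.symm (ι z)) := by
        rw [hzy, ← (hone y).1 (hyz 1 le_rfl (by omega))]
        exact ((hF.contDiffAt (hG.mem_nhds hyG)).differentiableAt (by simp)).hasFDerivAt
      have h2 : DifferentiableAt ℝ φ.symm (ι z) :=
        (hφc.contDiffAt (φ.open_target.mem_nhds hzt)).differentiableAt (by simp)
      have h3 := h1.comp z (h2.hasFDerivAt.comp z ι.hasFDerivAt)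
      rw [ContinuousLinearMap.zero_comp] at h3
      exact h3.fderiv
    -- On `t`, F is locally Hölder of exponent n + 2, which divides the dimension, at most n + 1, by
    -- n + 2.
    have htt : dimH (F '' t) ≤ (n + 1) / (n + 2) := by
      have h : dimH (F '' t) ≤ dimH t / ((n + 2 : ℕ) : NNReal) := by
        refine dimH_image_le_of_locally_holder_on (by positivity) fun x hx => ?_
        obtain ⟨C, hC, r, hr, hCr⟩ :=
          hF.exists_norm_sub_le_of_iteratedFDeriv_eq_zero hG hx.1 (n + 1)
        refine ⟨C.toNNReal, t ∩ Metric.ball x r,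
          inter_mem_nhdsWithin _ (Metric.ball_mem_nhds x hr), ?_⟩
        rintro y ⟨hyt, hy⟩ z ⟨-, hz⟩
        have := hCr y hy z hz hyt.2
        rw [edist_dist, edist_dist, dist_comm, dist_comm y, dist_eq_norm, dist_eq_norm,
          NNReal.coe_natCast, ENNReal.rpow_natCast, ← ENNReal.ofReal_pow (norm_nonneg _)]
        change _ ≤ ENNReal.ofReal C * _
        rw [← ENNReal.ofReal_mul hC]
        exact ENNReal.ofReal_le_ofReal this
      refine h.trans ?_
      have h2 : dimH t ≤ ((n + 1 : ℕ) : ENNReal) := by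
        refine (dimH_mono (subset_univ t)).trans ?_
        rw [Real.dimH_univ_eq_finrank, finrank_euclideanSpace_fin]
      push_cast at h2 ⊢
      gcongr
    have hle : (n : ENNReal) / (n + 1) ≤ (n + 1) / (n + 2) := by
      have h : (n : ℝ) / (n + 1) ≤ (n + 1) / (n + 2) := by
        rw [div_le_div_iff₀ (by positivity) (by positivity)]
        nlinarith
      have := ENNReal.ofReal_le_ofReal h
      rw [ENNReal.ofReal_div_of_pos (by positivity), ENNReal.ofReal_div_of_pos (by positivity),
        ENNReal.ofReal_add (by positivity) (by positivity),
        ENNReal.ofReal_add (by positivity) (by positivity)] at this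
      simpa using this
    refine (dimH_mono (image_mono hcover)).trans ?_
    rw [image_union, image_iUnion, dimH_union, dimH_iUnion]
    have h12 : ((n + 1 : ℕ) : ENNReal) + 1 = n + 2 := by push_cast; ring
    rw [h12]
    push_cast
    exact max_le (iSup_le fun k => (hst k).trans hle) htt

/-- The set of critical values has dimension less than 1, so its complement is dense in ℝ. -/
theorem ContDiffOn.exists_isRegularValueOn {n : ℕ} {F : EuclideanSpace ℝ (Fin n) → ℝ}
    {G : Set (EuclideanSpace ℝ (Fin n))} (hG : IsOpen G) (hF : ContDiffOn ℝ ∞ F G) {b c : ℝ}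
    (hbc : b < c) : ∃ a ∈ Ioo b c, IsRegularValueOn F G a := by
  have hd : dimH (F '' {x | x ∈ G ∧ fderiv ℝ F x = 0}) < Module.finrank ℝ ℝ := by
    refine (hF.dimH_image_critical_le n hG).trans_lt ?_
    rw [Module.finrank_self, Nat.cast_one]
    refine ENNReal.div_lt_of_lt_mul ?_
    rw [one_mul]
    exact ENNReal.lt_add_right (by simp) (by simp)
  obtain ⟨a, ha, haI⟩ := (dense_compl_of_dimH_lt_finrank hd).exists_mem_open isOpen_Ioo
    (nonempty_Ioo.2 hbc)
  refine ⟨a, haI, fun x hx hxa => ?_⟩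
  have h0 : fderiv ℝ F x ≠ 0 := fun h => ha ⟨x, ⟨hx, h⟩, hxa⟩
  exact LinearMap.surjective (f := (fderiv ℝ F x).toLinearMap)
    (fun h => h0 (ContinuousLinearMap.coe_injective h))

/-! ### Regular level sets and the component of the origin -/

theorem IsPosDefOn.nonneg {n : ℕ} {F : EuclideanSpace ℝ (Fin n) → ℝ}
    {G : Set (EuclideanSpace ℝ (Fin n))} (hF : IsPosDefOn F G) {x : EuclideanSpace ℝ (Fin n)}
    (hx : x ∈ G) : 0 ≤ F x := by
  by_cases h : x = 0
  · rw [h, hF.1]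
  · exact (hF.2 x hx h).le

/-- Near a point of a regular level set, the chart straightening `F` splits the space into connected
sides. -/
theorem IsRegularValueOn.exists_chart {n : ℕ} {F : EuclideanSpace ℝ (Fin (n + 1)) → ℝ}
    {G : Set (EuclideanSpace ℝ (Fin (n + 1)))} (hG : IsOpen G) (hF : ContDiffOn ℝ ∞ F G) {a : ℝ}
    (ha : IsRegularValueOn F G a) {p : EuclideanSpace ℝ (Fin (n + 1))} (hp : p ∈ G)
    (hpa : F p = a) :
    ∃ φ : OpenPartialHomeomorph (EuclideanSpace ℝ (Fin (n + 1))) (EuclideanSpace ℝ (Fin (n + 1))),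
      p ∈ φ.source ∧ φ.source ⊆ G ∧ ContDiffOn ℝ ∞ φ φ.source ∧
      ContDiffOn ℝ ∞ φ.symm φ.target ∧ (∀ x ∈ φ.source, φ x (Fin.last n) = F x - a) ∧
      IsPreconnected {x | x ∈ φ.source ∧ F x ≤ a} ∧ IsPreconnected {x | x ∈ φ.source ∧ a < F x} ∧
      ∀ x ∈ φ.source, F x = a → x ∈ closure {x | x ∈ φ.source ∧ a < F x} := by
  have hFp : fderiv ℝ (fun x => F x - a) p ≠ 0 := by
    rw [fderiv_sub_const]
    intro h
    obtain ⟨v, hv⟩ := ha p hp hpa 1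
    rw [h] at hv
    simp at hv
  obtain ⟨φ, hpφ, hφG, hφ, hφs, hconv, hlast⟩ :=
    (hF.sub contDiffOn_const).exists_straightening (g := fun x => F x - a) hG hp hFp
  have himage : ∀ s : Set ℝ, {x | x ∈ φ.source ∧ F x - a ∈ s} =
      φ.symm '' (φ.target ∩ (EuclideanSpace.proj (Fin.last n) :
        EuclideanSpace ℝ (Fin (n + 1)) →L[ℝ] ℝ) ⁻¹' s) := by
    intro s
    ext x
    constructor
    · rintro ⟨hx, hxs⟩
      refine ⟨φ x, ⟨φ.map_source hx, ?_⟩, φ.left_inv hx⟩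
      change φ x (Fin.last n) ∈ s
      rwa [hlast x hx]
    · rintro ⟨y, ⟨hy, hys⟩, rfl⟩
      refine ⟨φ.map_target hy, ?_⟩
      rw [← hlast _ (φ.map_target hy), φ.right_inv hy]
      exact hys
  -- Each side is the image of a half-space slice of the convex chart target.
  have hpre : ∀ s : Set ℝ, Convex ℝ s → IsPreconnected {x | x ∈ φ.source ∧ F x - a ∈ s} := by
    intro s hs
    rw [himage s]
    exact (hconv.inter (hs.is_linear_preimage
      (EuclideanSpace.proj (Fin.last n) :
        EuclideanSpace ℝ (Fin (n + 1)) →L[ℝ] ℝ).toLinearMap.isLinear)).isPreconnected.image _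
      (φ.continuousOn_symm.mono inter_subset_left)
  refine ⟨φ, hpφ, hφG, hφ, hφs, hlast, ?_, ?_, ?_⟩
  · simpa only [mem_Iic, sub_nonpos] using hpre (Iic 0) (convex_Iic 0)
  · simpa only [mem_Ioi, sub_pos] using hpre (Ioi 0) (convex_Ioi 0)
  · intro x hx hxa
    have hc : Tendsto (fun t : ℝ => φ x + t • EuclideanSpace.single (Fin.last n) (1 : ℝ))
        (𝓝[>] 0) (𝓝 (φ x)) := by
      have h : Continuous fun t : ℝ => φ x + t • EuclideanSpace.single (Fin.last n) (1 : ℝ) := by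
        fun_prop
      simpa using (h.tendsto 0).mono_left nhdsWithin_le_nhds
    have hs : Tendsto φ.symm (𝓝 (φ x)) (𝓝 x) := by
      have := (φ.continuousAt_symm (φ.map_source hx)).tendsto
      rwa [φ.left_inv hx] at this
    refine mem_closure_of_tendsto (hs.comp hc) ?_
    filter_upwards [hc (φ.open_target.mem_nhds (φ.map_source hx)), self_mem_nhdsWithin]
      with t ht ht0
    refine ⟨φ.map_target ht, ?_⟩
    have h := hlast _ (φ.map_target ht)
    rw [φ.right_inv ht] at h
    have h2 := hlast x hx
    simp only [PiLp.add_apply, h2, PiLp.smul_apply, PiLp.single_apply, if_true,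
      smul_eq_mul, mul_one, hxa] at h
    have ht0' : 0 < t := ht0
    change a < F (φ.symm _)
    linarith

section OriginComponent

variable {n : ℕ} {F : EuclideanSpace ℝ (Fin n) → ℝ} {G : Set (EuclideanSpace ℝ (Fin n))} {a ε : ℝ}

theorem originComponent_subset : originComponent F G a ⊆ {x | x ∈ G ∧ F x ∈ uIcc 0 a} :=
  connectedComponentIn_subset _ _

theorem zero_mem_originComponent (h0 : (0 : EuclideanSpace ℝ (Fin n)) ∈ G) (hF0 : F 0 = 0) :
    (0 : EuclideanSpace ℝ (Fin n)) ∈ originComponent F G a :=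
  mem_connectedComponentIn ⟨h0, by rw [hF0]; exact left_mem_uIcc⟩

theorem le_of_mem_originComponent (ha : 0 < a) {x : EuclideanSpace ℝ (Fin n)}
    (hx : x ∈ originComponent F G a) : F x ≤ a := by
  have h := (originComponent_subset hx).2
  rw [uIcc_of_le ha.le] at h
  exact h.2

theorem originComponent_mono {b : ℝ} (ha : 0 < a) (hab : a ≤ b) :
    originComponent F G a ⊆ originComponent F G b :=
  connectedComponentIn_mono _ fun x hx => ⟨hx.1, by
    have := hx.2
    rw [uIcc_of_le ha.le] at this
    rw [uIcc_of_le (ha.le.trans hab)]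
    exact ⟨this.1, this.2.trans hab⟩⟩

theorem IsPosDefOn.subset_originComponent (hF : IsPosDefOn F G) (ha : 0 < a)
    {T : Set (EuclideanSpace ℝ (Fin n))} (hT : IsPreconnected T) (hTG : T ⊆ G)
    (hTa : ∀ x ∈ T, F x ≤ a) {x : EuclideanSpace ℝ (Fin n)} (hx : x ∈ T)
    (hxP : x ∈ originComponent F G a) : T ⊆ originComponent F G a := by
  rw [originComponent, connectedComponentIn_eq hxP]
  refine hT.subset_connectedComponentIn hx fun y hy => ⟨hTG hy, ?_⟩
  rw [uIcc_of_le ha.le]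
  exact ⟨hF.nonneg (hTG hy), hTa y hy⟩

theorem originComponent_subset_ball (h0 : (0 : EuclideanSpace ℝ (Fin n)) ∈ G) (hF0 : F 0 = 0)
    (hε : 0 < ε) (ha : 0 < a) (hsphere : ∀ x ∈ Metric.sphere 0 ε, a < F x) :
    originComponent F G a ⊆ Metric.ball 0 ε := by
  refine isPreconnected_connectedComponentIn.subset_left_of_subset_union
    (v := (Metric.closedBall 0 ε)ᶜ) Metric.isOpen_ball Metric.isClosed_closedBall.isOpen_compl
    ?_ ?_ ⟨0, zero_mem_originComponent h0 hF0, Metric.mem_ball_self hε⟩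
  · exact Set.disjoint_left.2 fun x hx hx' => hx' (Metric.ball_subset_closedBall hx)
  · intro x hx
    rcases lt_trichotomy (dist x 0) ε with h | h | h
    · exact Or.inl h
    · exact absurd (hsphere x h) (le_of_mem_originComponent ha hx).not_gt
    · exact Or.inr (by simpa using h)

/-- The closure is connected and, as the closed ball lies in G, still inside the sublevel set;
maximality of the component gives equality. -/
theorem isClosed_originComponent (hF : ContinuousOn F G) (hεG : Metric.closedBall 0 ε ⊆ G)
    (h0 : (0 : EuclideanSpace ℝ (Fin n)) ∈ G) (hF0 : F 0 = 0)
    (hP : originComponent F G a ⊆ Metric.closedBall 0 ε) :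
    IsClosed (originComponent F G a) := by
  refine isClosed_of_closure_subset ?_
  have h0P : (0 : EuclideanSpace ℝ (Fin n)) ∈ originComponent F G a :=
    zero_mem_originComponent h0 hF0
  refine isPreconnected_connectedComponentIn.closure.subset_connectedComponentIn
    (subset_closure h0P) ?_
  have hc : IsClosed (Metric.closedBall 0 ε ∩ F ⁻¹' uIcc 0 a) :=
    (hF.mono hεG).preimage_isClosed_of_isClosed Metric.isClosed_closedBall isClosed_Icc
  have hsub : originComponent F G a ⊆ Metric.closedBall 0 ε ∩ F ⁻¹' uIcc 0 a :=
    fun x hx => ⟨hP hx, (originComponent_subset hx).2⟩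
  exact (closure_minimal hsub hc).trans fun x hx => ⟨hεG hx.1, hx.2⟩

theorem IsPosDefOn.eq_of_mem_frontier_originComponent (hG : IsOpen G) (hFc : ContinuousOn F G)
    (hF : IsPosDefOn F G) (ha : 0 < a) (hP : IsClosed (originComponent F G a))
    {x : EuclideanSpace ℝ (Fin n)} (hx : x ∈ frontier (originComponent F G a)) : F x = a := by
  have hxP := hP.frontier_subset hx
  have hxG := (originComponent_subset hxP).1
  refine (le_of_mem_originComponent ha hxP).eq_of_not_lt fun hlt => ?_
  obtain ⟨r, hr, hball⟩ := Metric.isOpen_iff.1 (hFc.isOpen_inter_preimage hG (isOpen_Iio (a := a)))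
    x ⟨hxG, hlt⟩
  have hsub : Metric.ball x r ⊆ originComponent F G a :=
    hF.subset_originComponent ha Metric.isPreconnected_ball (fun y hy => (hball hy).1)
      (fun y hy => (hball hy).2.le) (Metric.mem_ball_self hr) hxP
  exact hx.2 (mem_interior.2 ⟨_, hsub, Metric.isOpen_ball, Metric.mem_ball_self hr⟩)

end OriginComponent

/-! ### The outer boundary as a hypersurface -/

/-- The boundary of the component containing a far point `e` of the complement of the origin
component of a small regular sublevel set is a hypersurface around the origin. -/
theorem IsPosDefOn.outer_frontier {n : ℕ} (hn : 1 ≤ n)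
    {G : Set (EuclideanSpace ℝ (Fin (n + 1)))} (hG : IsOpen G)
    {F : EuclideanSpace ℝ (Fin (n + 1)) → ℝ} (hFs : ContDiffOn ℝ ∞ F G) (hF : IsPosDefOn F G)
    {a ε : ℝ} (ha : 0 < a) (hreg : IsRegularValueOn F G a) (hε : 0 < ε)
    (hεG : Metric.closedBall 0 ε ⊆ G) (hsphere : ∀ x ∈ Metric.sphere 0 ε, a < F x)
    {e : EuclideanSpace ℝ (Fin (n + 1))} (he : ε < ‖e‖) :
    IsHypersurfaceIn G (frontier (connectedComponentIn (originComponent F G a)ᶜ e)) ∧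
    BoundsAroundOrigin (frontier (connectedComponentIn (originComponent F G a)ᶜ e))
      (connectedComponentIn (originComponent F G a)ᶜ e)ᶜ ∧
    F '' frontier (connectedComponentIn (originComponent F G a)ᶜ e) = {a} ∧
    IsConnectedComponentOf (frontier (connectedComponentIn (originComponent F G a)ᶜ e))
      (frontier (originComponent F G a)) ∧
    (connectedComponentIn (originComponent F G a)ᶜ e)ᶜ ⊆ Metric.closedBall 0 ε := by
  have h0 : (0 : EuclideanSpace ℝ (Fin (n + 1))) ∈ G := hεG (Metric.mem_closedBall_self hε.le)
  have hPball : originComponent F G a ⊆ Metric.closedBall 0 ε :=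
    (originComponent_subset_ball h0 hF.1 hε ha hsphere).trans Metric.ball_subset_closedBall
  have hPc : IsClosed (originComponent F G a) :=
    isClosed_originComponent hFs.continuousOn hεG h0 hF.1 hPball
  have h0P : (0 : EuclideanSpace ℝ (Fin (n + 1))) ∈ originComponent F G a :=
    zero_mem_originComponent h0 hF.1
  have hPpre : IsPreconnected (originComponent F G a) := isPreconnected_connectedComponentIn
  have hPfr : ∀ x ∈ frontier (originComponent F G a), F x = a := fun x hx =>
    hF.eq_of_mem_frontier_originComponent hG hFs.continuousOn ha hPc hx
  have hPG : originComponent F G a ⊆ G := fun x hx => (originComponent_subset hx).1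
  have hPle : ∀ x ∈ originComponent F G a, F x ≤ a := fun x hx => le_of_mem_originComponent ha hx
  have hsubP : ∀ T : Set (EuclideanSpace ℝ (Fin (n + 1))), IsPreconnected T → T ⊆ G →
      (∀ x ∈ T, F x ≤ a) → ∀ x ∈ T, x ∈ originComponent F G a → T ⊆ originComponent F G a :=
    fun T h1 h2 h3 x h4 h5 => hF.subset_originComponent ha h1 h2 h3 h4 h5
  generalize originComponent F G a = P at *
  have heP : e ∈ Pᶜ := fun h => by
    have := hPball h
    rw [mem_closedBall_zero_iff] at this
    linarith
  have hUopen : IsOpen (connectedComponentIn Pᶜ e) := hPc.isOpen_compl.connectedComponentIn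
  have heU : e ∈ connectedComponentIn Pᶜ e := mem_connectedComponentIn heP
  have hUP : connectedComponentIn Pᶜ e ⊆ Pᶜ := connectedComponentIn_subset _ _
  have hHP : frontier (connectedComponentIn Pᶜ e) ⊆ P :=
    hPc.frontier_connectedComponentIn_compl_subset e
  have hHpre : IsPreconnected (frontier (connectedComponentIn Pᶜ e)) :=
    isPreconnected_frontier_connectedComponentIn_compl hPpre hPc h0P e
  have hUcompl : (Metric.closedBall 0 ε)ᶜ ⊆ connectedComponentIn Pᶜ e := by
    refine (isPreconnected_compl_closedBall_zero ?_ hε.le).subset_connectedComponentIn ?_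
      (compl_subset_compl.2 hPball)
    · rw [← Module.finrank_eq_rank, finrank_euclideanSpace_fin]
      exact_mod_cast Nat.lt_add_of_pos_left hn
    · simpa using he
  have hUin : ∀ z ∈ connectedComponentIn Pᶜ e, ∀ T : Set (EuclideanSpace ℝ (Fin (n + 1))),
      IsPreconnected T → T ⊆ Pᶜ → z ∈ T → T ⊆ connectedComponentIn Pᶜ e := by
    intro z hz T hT hTP hzT
    rw [connectedComponentIn_eq hz]
    exact hT.subset_connectedComponentIn hzT hTP
  generalize connectedComponentIn Pᶜ e = U at *
  have hHfr : frontier U ⊆ frontier P := by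
    intro x hx
    rw [hPc.frontier_eq]
    refine ⟨hHP hx, fun hxi => ?_⟩
    obtain ⟨z, hzP, hzU⟩ := mem_closure_iff.1 hx.1 _ isOpen_interior hxi
    exact hUP hzU (interior_subset hzP)
  have hHne : (frontier U).Nonempty := by
    rw [nonempty_frontier_iff]
    exact ⟨⟨e, heU⟩, fun h => hUP (h ▸ mem_univ 0 : (0 : EuclideanSpace ℝ (Fin (n + 1))) ∈ U) h0P⟩
  have hball : Uᶜ ⊆ Metric.closedBall 0 ε := compl_subset_comm.1 hUcompl
  -- The low side of the chart is connected and contains x ∈ P, so it lies in P. The high side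
  -- avoids P and meets U, so it lies in U.
  have hlocal : ∀ x ∈ frontier U, ∃ φ : OpenPartialHomeomorph (EuclideanSpace ℝ (Fin (n + 1)))
      (EuclideanSpace ℝ (Fin (n + 1))), x ∈ φ.source ∧ ContDiffOn ℝ ∞ φ φ.source ∧
      ContDiffOn ℝ ∞ φ.symm φ.target ∧ (∀ y ∈ φ.source, φ y (Fin.last n) = F y - a) ∧
      ∀ y ∈ φ.source, y ∈ frontier U ↔ F y = a := by
    intro x hx
    have hxP := hHP hx
    have hxa := hPfr x (hHfr hx)
    obtain ⟨φ, hxφ, hφG, hφ, hφs, hlast, hlow, hup, hcl⟩ := hreg.exists_chart hG hFs (hPG hxP) hxa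
    have hlowP : {y | y ∈ φ.source ∧ F y ≤ a} ⊆ P :=
      hsubP _ hlow (fun y hy => hφG hy.1) (fun y hy => hy.2) x ⟨hxφ, hxa.le⟩ hxP
    obtain ⟨z, hzφ, hzU⟩ := mem_closure_iff.1 hx.1 _ φ.open_source hxφ
    have hza : a < F z := not_le.1 fun h => hUP hzU (hlowP ⟨hzφ, h⟩)
    have hupU : {y | y ∈ φ.source ∧ a < F y} ⊆ U :=
      hUin z hzU _ hup (fun y hy hyP => (hPle y hyP).not_gt hy.2) ⟨hzφ, hza⟩
    refine ⟨φ, hxφ, hφ, hφs, hlast, fun y hy => ⟨fun h => hPfr y (hHfr h), fun h => ?_⟩⟩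
    rw [hUopen.frontier_eq]
    exact ⟨closure_mono hupU (hcl y hy h), fun hyU => hUP hyU (hlowP ⟨hy, h.le⟩)⟩
  refine ⟨⟨⟨hHne, hHpre⟩, ?_, ⟨Nat.sub_le _ _, ?_⟩, hHP.trans hPG⟩, ⟨?_, ?_, ?_, ?_⟩, ?_, ?_, hball⟩
  · exact (isCompact_closedBall 0 ε).of_isClosed_subset isClosed_frontier (hHP.trans hPball)
  · intro x hx
    obtain ⟨φ, hxφ, hφ, hφs, hlast, hiff⟩ := hlocal x hx
    refine ⟨φ, hxφ, hφ, hφs, fun y hy => ?_⟩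
    rw [hiff y hy, ← sub_eq_zero, ← hlast y hy]
    constructor
    · intro h k hk
      obtain rfl : k = Fin.last n := Fin.ext (by simp at hk ⊢; omega)
      exact h
    · exact fun h => h _ (by simp)
  · exact (isCompact_closedBall 0 ε).of_isClosed_subset hUopen.isClosed_compl hball
  · exact fun h => hUP h h0P
  · intro h
    have := hPfr _ (hHfr h)
    rw [hF.1] at this
    exact ha.ne this
  · exact frontier_compl U
  · refine Subset.antisymm (image_subset_iff.2 fun x hx => hPfr x (hHfr hx)) ?_
    obtain ⟨x, hx⟩ := hHne
    exact singleton_subset_iff.2 ⟨x, hx, hPfr x (hHfr hx)⟩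
  · obtain ⟨x, hx⟩ := hHne
    refine ⟨x, hHfr hx, Subset.antisymm (hHpre.subset_connectedComponentIn hx hHfr) ?_⟩
    choose φ hxφ _ _ _ hiff using hlocal
    intro y hy
    by_contra hyH
    -- A larger component of the frontier of P would be separated by the union of the charts and the
    -- complement of the frontier of U.
    obtain ⟨z, hzC, hzO, hzH⟩ := isPreconnected_connectedComponentIn
      (⋃ w : frontier U, (φ w w.2).source) (frontier U)ᶜ
      (isOpen_iUnion fun w => (φ w w.2).open_source) isClosed_frontier.isOpen_compl
      (fun w _ => (em (w ∈ frontier U)).imp (fun h => mem_iUnion.2 ⟨⟨w, h⟩, hxφ w h⟩) id)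
      ⟨x, mem_connectedComponentIn (hHfr hx), mem_iUnion.2 ⟨⟨x, hx⟩, hxφ x hx⟩⟩ ⟨y, hy, hyH⟩
    obtain ⟨w, hzw⟩ := mem_iUnion.1 hzO
    exact hzH ((hiff w w.2 z hzw).2 (hPfr z (connectedComponentIn_subset _ _ hzC)))

/-! ### Choice of the values and conclusion -/

theorem exists_strictAnti_seq {Q : ℕ → ℝ → Prop}
    (hQ : ∀ k, ∀ c > 0, ∃ a, 0 < a ∧ a < c ∧ Q k a) :
    ∃ a : ℕ → ℝ, StrictAnti a ∧ (∀ k, 0 < a k) ∧ (∀ k, Q k (a k)) := by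
  choose f hpos hlt hQf using fun k (c : {c : ℝ // 0 < c}) => hQ k c c.2
  set a : ℕ → {c : ℝ // 0 < c} := fun k =>
    Nat.rec ⟨f 0 ⟨1, one_pos⟩, hpos _ _⟩ (fun k c => ⟨f (k + 1) c, hpos _ _⟩) k with ha
  refine ⟨fun k => a k, strictAnti_nat_of_succ_lt fun k => hlt (k + 1) (a k), fun k => (a k).2, ?_⟩
  rintro (_ | k)
  · exact hQf 0 _
  · exact hQf (k + 1) (a k)

theorem IsPosDefOn.exists_convergentSequence {n : ℕ} (hn : 2 ≤ n)
    {G : Set (EuclideanSpace ℝ (Fin n))} (hG : IsOpen G)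
    (h0 : (0 : EuclideanSpace ℝ (Fin n)) ∈ G) {F : EuclideanSpace ℝ (Fin n) → ℝ}
    (hF : ContDiffOn ℝ ∞ F G) (hdef : IsPosDefOn F G) :
    ∃ (H : ℕ → Set (EuclideanSpace ℝ (Fin n))) (a : ℕ → ℝ),
      IsConvergentSequence G H ∧
      (∀ i, F '' H i = {a i}) ∧
      (∀ i, IsRegularValueOn F G (a i)) ∧
      (∀ i, IsConnectedComponentOf (H i) (frontier (originComponent F G (a i)))) ∧
      Tendsto a atTop (𝓝 0) := by
  obtain ⟨n, rfl⟩ := Nat.exists_eq_add_of_le' (one_le_two.trans hn)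
  obtain ⟨δ, hδ, hδG⟩ := Metric.nhds_basis_closedBall.mem_iff.1 (hG.mem_nhds h0)
  set ε : ℕ → ℝ := fun k => δ / (k + 1) with hε
  have hεpos : ∀ k, 0 < ε k := fun k => by positivity
  have hεδ : ∀ k, ε k ≤ δ := fun k => div_le_self hδ.le (by simp)
  have hε0 : Tendsto ε atTop (𝓝 0) := by
    simpa [hε, div_eq_mul_inv] using
      (tendsto_one_div_add_atTop_nhds_zero_nat (𝕜 := ℝ)).const_mul δ
  have hεG : ∀ k, Metric.closedBall 0 (ε k) ⊆ G := fun k =>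
    (Metric.closedBall_subset_closedBall (hεδ k)).trans hδG
  -- A single e beyond all the balls serves every k, so the outer components grow as a decreases.
  obtain ⟨e, he⟩ := NormedSpace.exists_lt_norm ℝ (EuclideanSpace ℝ (Fin (n + 1))) δ
  obtain ⟨a, ha, hapos, haQ⟩ := exists_strictAnti_seq (Q := fun k a => a < 1 / ((k : ℝ) + 1) ∧
      IsRegularValueOn F G a ∧ ∀ x ∈ Metric.sphere 0 (ε k), a < F x) fun k c hc => by
    obtain ⟨x₀, hx₀, hmin⟩ := (isCompact_sphere (0 : EuclideanSpace ℝ (Fin (n + 1)))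
      (ε k)).exists_isMinOn (NormedSpace.sphere_nonempty.2 (hεpos k).le)
      (hF.continuousOn.mono (Metric.sphere_subset_closedBall.trans (hεG k)))
    have hx₀0 : 0 < F x₀ := hdef.2 x₀ (hεG k (Metric.sphere_subset_closedBall hx₀))
      (Metric.ne_of_mem_sphere hx₀ (hεpos k).ne')
    obtain ⟨a, ⟨ha0, hac⟩, hreg⟩ := hF.exists_isRegularValueOn hG
      (lt_min hc (lt_min hx₀0 (Nat.one_div_pos_of_nat (α := ℝ) (n := k))))
    rw [lt_min_iff, lt_min_iff] at hac
    exact ⟨a, ha0, hac.1, hac.2.2, hreg, fun x hx => hac.2.1.trans_le (hmin hx)⟩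
  have hmain := fun k => hdef.outer_frontier (by omega) hG hF (hapos k) (haQ k).2.1 (hεpos k)
    (hεG k) (haQ k).2.2 ((hεδ k).trans_lt he)
  have hFH : ∀ i, ∀ x ∈ frontier (connectedComponentIn (originComponent F G (a i))ᶜ e),
      F x = a i := fun i x hx => (hmain i).2.2.1.subset (mem_image_of_mem F hx)
  have hdisj : ∀ i j, i ≠ j →
      Disjoint (frontier (connectedComponentIn (originComponent F G (a i))ᶜ e))
        (frontier (connectedComponentIn (originComponent F G (a j))ᶜ e)) := by
    intro i j hij
    refine Set.disjoint_left.2 fun x hxi hxj => hij (ha.injective ?_)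
    rw [← hFH i x hxi, hFH j x hxj]
  refine ⟨fun i => frontier (connectedComponentIn (originComponent F G (a i))ᶜ e), a,
    ⟨fun i => (hmain i).1, hdisj, fun i => (connectedComponentIn (originComponent F G (a i))ᶜ e)ᶜ,
      fun i => (hmain i).2.1, ?_, fun i j hij => ?_⟩, fun i => (hmain i).2.2.1,
    fun i => (haQ i).2.1, fun i => (hmain i).2.2.2.1, ?_⟩
  · refine Subset.antisymm (fun x hx => ?_)
      (singleton_subset_iff.2 (mem_iInter.2 fun i => (hmain i).2.1.zero_mem))
    have hx' : ∀ k, ‖x‖ ≤ ε k := fun k =>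
      mem_closedBall_zero_iff.1 ((hmain k).2.2.2.2 (mem_iInter.1 hx k))
    exact norm_le_zero_iff.1 (ge_of_tendsto' hε0 hx')
  · refine LE.le.ssubset_of_ne (compl_subset_compl.2 (connectedComponentIn_mono _
      (compl_subset_compl.2 (originComponent_mono (hapos j) (ha hij).le)))) fun h => ?_
    obtain ⟨x, hx⟩ := (hmain i).1.connected.nonempty
    refine Set.disjoint_left.1 (hdisj i j hij.ne) hx ?_
    rwa [compl_injective h]
  · exact squeeze_zero (fun k => (hapos k).le) (fun k => (haQ k).1.le)
      tendsto_one_div_add_atTop_nhds_zero_nat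

theorem originComponent_neg {n : ℕ} (F : EuclideanSpace ℝ (Fin n) → ℝ)
    (G : Set (EuclideanSpace ℝ (Fin n))) (a : ℝ) :
    originComponent (-F) G a = originComponent F G (-a) := by
  have h : ∀ x, (-F) x ∈ uIcc 0 a ↔ F x ∈ uIcc 0 (-a) := fun x => by
    rw [Pi.neg_apply, mem_uIcc, mem_uIcc]
    constructor <;> rintro (h | h) <;> [right; left; right; left] <;> constructor <;> linarith
  simp only [originComponent, h]

theorem IsRegularValueOn.of_neg {n : ℕ} {F : EuclideanSpace ℝ (Fin n) → ℝ}
    {G : Set (EuclideanSpace ℝ (Fin n))} {a : ℝ} (h : IsRegularValueOn (-F) G a) :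
    IsRegularValueOn F G (-a) := by
  intro x hx hxa y
  obtain ⟨v, hv⟩ := h x hx (by simp [hxa]) y
  rw [fderiv_neg] at hv
  exact ⟨-v, by simpa using hv⟩

theorem lemma2p1 (n : ℕ) (hn : 2 ≤ n) (G : Set (EuclideanSpace ℝ (Fin n))) (hG : IsOpen G)
    (h0 : (0 : EuclideanSpace ℝ (Fin n)) ∈ G) (F : EuclideanSpace ℝ (Fin n) → ℝ)
    (hF : ContDiffOn ℝ ∞ F G) (hdef : IsPosDefOn F G ∨ IsNegDefOn F G) :
    ∃ (H : ℕ → Set (EuclideanSpace ℝ (Fin n))) (a : ℕ → ℝ),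
      IsConvergentSequence G H ∧
      (∀ i, F '' H i = {a i}) ∧
      (∀ i, IsRegularValueOn F G (a i)) ∧
      (∀ i, IsConnectedComponentOf (H i) (frontier (originComponent F G (a i)))) ∧
      Tendsto a atTop (𝓝 0) := by
  rcases hdef with hdef | hdef
  · exact hdef.exists_convergentSequence hn hG h0 hF
  · have hdef' : IsPosDefOn (-F) G :=
      ⟨by simp [hdef.1], fun x hx hx0 => neg_pos.2 (hdef.2 x hx hx0)⟩
    obtain ⟨H, a, hH, hFH, hreg, hcomp, ha⟩ := hdef'.exists_convergentSequence hn hG h0 hF.neg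
    refine ⟨H, fun i => -a i, hH, fun i => ?_, fun i => (hreg i).of_neg, fun i => ?_, ?_⟩
    · have h := congrArg (image Neg.neg) (hFH i)
      rw [← image_comp, image_singleton] at h
      rw [← h]
      exact image_congr fun x _ => (neg_neg (F x)).symm
    · rw [← originComponent_neg]
      exact hcomp i
    · simpa using ha.neg
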